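/- Let $P_X$ be a probability measure on $\mathbb{R}^n$ which is concentrated on a set $\mathcal{X}\subseteq\mathbb{R}^n$, and let $x_1,x_2,\dots$ be i.i.d. random vectors with law $P_X$; $\mathbb{P}$ denotes probability with respect to this sequence. Fix a polynomial order $m$, a noise parameter $\sigma_0^2>0$, a threshold $\eta>0$, PAC parameters $\epsilon,\delta\in(0,1)$, an initial sample size $N_0\ge 0$ and a batch size $N_b\ge 1$. Let $z_m(x)$ be the vector of all monomials of degree at most $m$ evaluated at $x$. For $i\ge 1$ put $N=N_0+iN_b$ (the sample size in iteration $i$) and $$\hat M^i=\sigma_0^2 I+\frac1N\sum_{j=1}^N z_m(x_j)z_m(x_j)^\top,\qquad C^i(x)=z_m(x)^\top(\hat M^i)^{-1}z_m(x).$$ Let $W_P\sim\mathcal{N}(0,\sigma_0^{-2}I)$ and, given the data, $W_Q\sim\mathcal{N}(0,(\hat M^i)^{-1})$. The empirical stochastic risk is $$\hat r_Q^i=\mathbb{E}_{W_Q}\Big[\frac1N\sum_{j=1}^N \mathbf{1}\{(W_Q^\top z_m(x_j))^2>\eta\}\Big].$$ With $D_{ber}(q\|p)=q\log\frac qp+(1-q)\log\frac{1-q}{1-p}$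 and $D_{KL}$ the Kullback--Leibler divergence, put $$\bar r^i=\sup\Big\{\beta\in(0,1): D_{ber}(\hat r_Q^i\,\|\,\beta)\le\frac{D_{KL}\big(\mathcal{N}(0,(\hat M^i)^{-1})\,\big\|\,\mathcal{N}(0,\sigma_0^{-2}I)\big)+\log\frac{N+1}{\delta}}{N}\Big\}.$$ Finally let $\epsilon^0=1$ and, for $i\ge1$, $$\epsilon^i=\frac{\bar r^i+\frac2N\log\frac{\pi^2i^2}{6\delta}}{1-F_1(1)},$$ where $F_1$ is the distribution function of the chi-square distribution with one degree of freedom. The algorithm performs the iterations $i=1,2,\dots$ while $\epsilon^{i-1}>\epsilon$; that is, it stops after the first iteration $T$ with $\epsilon^T\le\epsilon$ (if there is one), and it returns $\{x\in\mathcal{X}:C^T(x)\le\eta\}$. Then $$\mathbb{P}\big(\forall i\ge1:\ P_X(\{x\in\mathcal{X}:C^i(x)\le\eta\})\ge1-\epsilon^i\big)\ge1-\delta.$$ Consequently, with probability at least $1-\delta$, if the algorithm stops, say after iteration $T$, then its output satisfies $P_X(\{x\in\mathcal{X}:C^T(x)\le\eta\})\ge1-\epsilon$. -/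

import Mathlib

open MeasureTheory ProbabilityTheory
open scoped ENNReal

noncomputable section

namespace ChristoffelPAC

/-- Multi-indices `α = (α₁, …, αₙ)` with `α₁ + ⋯ + αₙ ≤ m`: they index the monomials of degree
at most `m` in `n` variables (each single exponent is then at most `m`). -/
abbrev MonoIdx (n m : ℕ) : Type :=
  {α : Fin n → Fin (m + 1) // ∑ k, (α k : ℕ) ≤ m}

variable {n : ℕ}

/-- The vector `z_m(x)` of all monomials of degree at most `m`, evaluated at `x ∈ ℝⁿ`. -/
def monomialVec (m : ℕ) (x : Fin n → ℝ) : MonoIdx n m → ℝ :=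
  fun α => ∏ k, x k ^ (α.1 k : ℕ)

/-- The regularized empirical moment matrix
`M̂ = σ₀² I + (1/N) ∑_{j < N} z_m(x_j) z_m(x_j)ᵀ` of the first `N` data points. -/
def momentMatrix (m : ℕ) (σ₀ : ℝ) (N : ℕ) (x : ℕ → Fin n → ℝ) :
    Matrix (MonoIdx n m) (MonoIdx n m) ℝ :=
  σ₀ ^ 2 • (1 : Matrix (MonoIdx n m) (MonoIdx n m) ℝ) +
    (1 / (N : ℝ)) • ∑ j ∈ Finset.range N,
      Matrix.vecMulVec (monomialVec m (x j)) (monomialVec m (x j))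

/-- The empirical inverse Christoffel function `C(y) = z_m(y)ᵀ M̂⁻¹ z_m(y)` of the first `N`
data points. -/
def invChristoffel (m : ℕ) (σ₀ : ℝ) (N : ℕ) (x : ℕ → Fin n → ℝ) (y : Fin n → ℝ) : ℝ :=
  monomialVec m y ⬝ᵥ Matrix.mulVec (momentMatrix m σ₀ N x)⁻¹ (monomialVec m y)

/-- The law `𝒩(0, σ₀⁻² I)` of the prior weight vector `W_P`. -/
def prior (n m : ℕ) (σ₀ : ℝ) : Measure (EuclideanSpace ℝ (MonoIdx n m)) :=
  multivariateGaussian 0 ((σ₀ ^ 2)⁻¹ • (1 : Matrix (MonoIdx n m) (MonoIdx n m) ℝ))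

/-- The law `𝒩(0, M̂⁻¹)` of the posterior weight vector `W_Q`, given the first `N` data points. -/
def posterior (m : ℕ) (σ₀ : ℝ) (N : ℕ) (x : ℕ → Fin n → ℝ) :
    Measure (EuclideanSpace ℝ (MonoIdx n m)) :=
  multivariateGaussian 0 (momentMatrix m σ₀ N x)⁻¹

/-- The concept `{y : (wᵀ z_m(y))² ≤ η}` with weight vector `w`. -/
def weightConcept (m : ℕ) (η : ℝ) (w : EuclideanSpace ℝ (MonoIdx n m)) : Set (Fin n → ℝ) :=
  {y | ((w : MonoIdx n m → ℝ) ⬝ᵥ monomialVec m y) ^ 2 ≤ η}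

/-- The zero-one membership loss `ℓ(c, y) = 1{y ∉ c}`. -/
def loss (c : Set (Fin n → ℝ)) (y : Fin n → ℝ) : ℝ :=
  Set.indicator cᶜ (fun _ => (1 : ℝ)) y

/-- The empirical stochastic risk `r̂_Q = E_{c ∼ Q} [(1/N) ∑_{j < N} ℓ(c, x_j)]` of the posterior
stochastic estimator `C_Q = {y : (W_Qᵀ z_m(y))² ≤ η}`. -/
def empStochRisk (m : ℕ) (σ₀ η : ℝ) (N : ℕ) (x : ℕ → Fin n → ℝ) : ℝ :=
  ∫ w, (1 / (N : ℝ)) * ∑ j ∈ Finset.range N, loss (weightConcept m η w) (x j)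
    ∂(posterior m σ₀ N x)

/-- The Kullback-Leibler divergence `D_ber(q ‖ p)` between the Bernoulli distributions with
parameters `q ∈ [0, 1]` and `p ∈ (0, 1)`. -/
def bernoulliKL (q p : ℝ) : ℝ :=
  q * Real.log (q / p) + (1 - q) * Real.log ((1 - q) / (1 - p))

/-- The complexity term `(D_KL(W_Q ‖ W_P) + log ((N + 1) / δ)) / N`, as an extended nonnegative
number. -/
def complexityTerm (m : ℕ) (σ₀ δ : ℝ) (N : ℕ) (x : ℕ → Fin n → ℝ) : ℝ≥0∞ :=
  (InformationTheory.klDiv (posterior m σ₀ N x) (prior n m σ₀) +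
    ENNReal.ofReal (Real.log (((N : ℝ) + 1) / δ))) / (N : ℝ≥0∞)

/-- The bound `r̄ = sup {β ∈ (0, 1) : D_ber(r̂_Q ‖ β) ≤ (D_KL(W_Q ‖ W_P) + log ((N + 1) / δ)) / N}`
on the stochastic risk. -/
def riskBound (m : ℕ) (σ₀ η δ : ℝ) (N : ℕ) (x : ℕ → Fin n → ℝ) : ℝ :=
  sSup {β : ℝ | β ∈ Set.Ioo (0 : ℝ) 1 ∧
    ENNReal.ofReal (bernoulliKL (empStochRisk m σ₀ η N x) β) ≤ complexityTerm m σ₀ δ N x}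

/-- The distribution function `F₁(t) = P(Z² ≤ t)`, `Z ∼ 𝒩(0, 1)`, of the chi-square distribution
with one degree of freedom. -/
def chiSqCDF (t : ℝ) : ℝ :=
  (gaussianReal 0 1).real {z : ℝ | z ^ 2 ≤ t}

/-- The number of samples collected once iteration `i` has drawn its batch: it starts at `N₀`, and
each iteration adds a batch of `Nb` samples. -/
def sampleSize (N₀ Nb : ℕ) : ℕ → ℕ
  | 0 => N₀
  | i + 1 => sampleSize N₀ Nb i + Nb

/-- The accuracy `ε^i` which the algorithm computes in iteration `i` on the data stream `x`:
`ε^0 = 1`, and for `i ≥ 1`, with `N` the current sample size,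
`ε^i = (r̄ + (2 / N) log (π² i² / (6 δ))) / (1 - F₁(1))`. -/
def accuracy (m : ℕ) (σ₀ η δ : ℝ) (N₀ Nb : ℕ) (x : ℕ → Fin n → ℝ) : ℕ → ℝ
  | 0 => 1
  | i + 1 =>
    (riskBound m σ₀ η δ (sampleSize N₀ Nb (i + 1)) x +
      2 / (sampleSize N₀ Nb (i + 1) : ℝ) *
        Real.log (Real.pi ^ 2 * ((i + 1 : ℕ) : ℝ) ^ 2 / (6 * δ))) / (1 - chiSqCDF 1)

/-- The support estimate `{y ∈ 𝒳 : C^i(y) ≤ η}` constructed in iteration `i`. -/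
def estimate (𝒳 : Set (Fin n → ℝ)) (m : ℕ) (σ₀ η : ℝ) (N₀ Nb : ℕ) (x : ℕ → Fin n → ℝ) (i : ℕ) :
    Set (Fin n → ℝ) :=
  {y ∈ 𝒳 | invChristoffel m σ₀ (sampleSize N₀ Nb i) x y ≤ η}

/-- The loop `while ε^i > ε` of the algorithm, run on the data stream `x`, exits right after
iteration `T`. -/
def StopsAt (m : ℕ) (σ₀ η δ ε : ℝ) (N₀ Nb : ℕ) (x : ℕ → Fin n → ℝ) (T : ℕ) : Prop :=
  accuracy m σ₀ η δ N₀ Nb x T ≤ ε ∧ ∀ i < T, ε < accuracy m σ₀ η δ N₀ Nb x i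

end ChristoffelPAC

end

/-! A PAC-Bayes bound that holds for all sample sizes at once, so no union bound over iterations is
needed. For a fixed weight `w` with error probability `p`, the count `S` of errors among `N` points
is binomial. Mixing the Bernoulli parameter uniformly over [0, 1] gives the likelihood ratio 1 /
((N+1) C(N,S) p^S (1-p)^(N-S)), a nonnegative supermartingale in `N` starting at 1. So is its
average over the prior, which does not depend on the data. By Ville's inequality
(`ville_inequality`) this average stays below 1/δ for all `N`, outside an event of probability at
most δ.

On the good event, the ratio dominates exponentials that are affine in `S` and `p`
(`exp_le_mixtureRatio`). Donsker-Varadhan holds for every posterior, including data-dependent ones,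
and turns this into N D_ber(r̂_Q ‖ r_Q) ≤ KL + log((N+1)/δ), where r_Q is the true stochastic risk.
Hence r_Q ≤ r̄ (`stochRisk_le_riskBound`).

Finally, W_Qᵀ z_m(y) is centred Gaussian with variance C(y). Where C(y) > η, its square exceeds η
with probability at least 1 - F₁(1), so (1 - F₁(1)) P_X(C > η) ≤ r_Q (`le_stochRisk`). The
logarithmic summand of ε^i is nonnegative slack. -/

namespace ChristoffelPAC

/-! ### Ville's maximal inequality -/

section Ville

variable {Ω : Type*} {mΩ : MeasurableSpace Ω}

/-- Ville's inequality for a nonnegative discrete-time supermartingale. -/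
theorem ville_inequality (μ : Measure Ω) (ℱ : Filtration ℕ mΩ) (V : ℕ → Ω → ℝ≥0∞)
    (hV : ∀ k, Measurable[ℱ k] (V k))
    (hstep : ∀ k B, MeasurableSet[ℱ k] B → ∫⁻ ω in B, V (k + 1) ω ∂μ ≤ ∫⁻ ω in B, V k ω ∂μ)
    (c : ℝ≥0∞) :
    c * μ {ω | ∃ k, c ≤ V k ω} ≤ ∫⁻ ω, V 0 ω ∂μ := by
  set U : ℕ → Set Ω := fun k => {ω | ∃ j ≤ k, c ≤ V j ω} with hU
  have hVm : ∀ k, Measurable (V k) := fun k => (hV k).mono (ℱ.le k) le_rfl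
  have hUm : ∀ k, MeasurableSet[ℱ k] (U k) := by
    intro k
    have : U k = ⋃ j ∈ Set.Iic k, {ω | c ≤ V j ω} := by
      ext ω; simp [hU]
    rw [this]
    refine MeasurableSet.biUnion (Set.to_countable _) fun j hj => ?_
    exact ((hV j).mono (ℱ.mono hj) le_rfl) measurableSet_Ici
  have hlow : ∀ k (B : Set Ω), MeasurableSet B → (∀ ω ∈ B, c ≤ V k ω) →
      c * μ B ≤ ∫⁻ ω in B, V k ω ∂μ := fun k B hB h => by
    rw [← setLIntegral_const]
    exact setLIntegral_mono (hVm k) h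
  -- The left side is a lower bound for the mean of `V` stopped when it first reaches `c`; it stays
  -- below the initial mean.
  have key : ∀ k, c * μ (U k) + ∫⁻ ω in (U k)ᶜ, V k ω ∂μ ≤ ∫⁻ ω, V 0 ω ∂μ := by
    intro k
    induction k with
    | zero =>
      rw [← lintegral_add_compl (μ := μ) (V 0) (ℱ.le 0 _ (hUm 0))]
      refine add_le_add ?_ le_rfl
      refine hlow 0 _ (ℱ.le 0 _ (hUm 0)) fun ω hω => ?_
      obtain ⟨j, hj, h⟩ := hω
      obtain rfl : j = 0 := by omega
      exact h
    | succ k ih =>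
      have hUk := ℱ.le k _ (hUm k)
      have hUk1 := ℱ.le (k + 1) _ (hUm (k + 1))
      have hsub : U k ⊆ U (k + 1) := fun ω ⟨j, hj, h⟩ => ⟨j, by omega, h⟩
      have hsplit : ∫⁻ ω in (U k)ᶜ, V (k + 1) ω ∂μ =
          ∫⁻ ω in U (k + 1) \ U k, V (k + 1) ω ∂μ + ∫⁻ ω in (U (k + 1))ᶜ, V (k + 1) ω ∂μ := by
        rw [← lintegral_union hUk1.compl]
        · congr 2
          ext ω
          have := @hsub ω
          simp only [Set.mem_compl_iff, Set.mem_union, Set.mem_sdiff]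
          tauto
        · exact Set.disjoint_left.2 fun ω h1 h2 => h2 h1.1
      calc c * μ (U (k + 1)) + ∫⁻ ω in (U (k + 1))ᶜ, V (k + 1) ω ∂μ
          ≤ c * μ (U k) + (∫⁻ ω in U (k + 1) \ U k, V (k + 1) ω ∂μ +
              ∫⁻ ω in (U (k + 1))ᶜ, V (k + 1) ω ∂μ) := by
            rw [← add_assoc]
            gcongr
            rw [← Set.union_sdiff_cancel hsub, measure_union Set.disjoint_sdiff_right
              (hUk1.diff hUk), mul_add, Set.union_sdiff_cancel hsub]
            gcongr
            refine hlow _ _ (hUk1.diff hUk) fun ω hω => ?_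
            obtain ⟨⟨j, hj, h⟩, hn⟩ := hω
            have : j = k + 1 := by
              by_contra hne
              exact hn ⟨j, by omega, h⟩
            exact this ▸ h
        _ = c * μ (U k) + ∫⁻ ω in (U k)ᶜ, V (k + 1) ω ∂μ := by rw [hsplit]
        _ ≤ c * μ (U k) + ∫⁻ ω in (U k)ᶜ, V k ω ∂μ := by
            gcongr 1
            exact hstep k _ (hUm k).compl
        _ ≤ _ := ih
  have hunion : {ω | ∃ k, c ≤ V k ω} = ⋃ k, U k := by
    ext ω
    simp only [hU, Set.mem_ofPred_eq, Set.mem_iUnion]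
    exact ⟨fun ⟨k, h⟩ => ⟨k, k, le_rfl, h⟩, fun ⟨_, j, _, h⟩ => ⟨j, h⟩⟩
  have hmono : Monotone U := fun a b hab ω ⟨j, hj, h⟩ => ⟨j, hj.trans hab, h⟩
  rw [hunion, hmono.measure_iUnion, ENNReal.mul_iSup]
  exact iSup_le fun k => le_self_add.trans (key k)

end Ville

/-! ### The uniform-mixture likelihood ratio -/

/-- The likelihood ratio of `S` errors out of `N` under a uniformly mixed Bernoulli parameter
against the Bernoulli parameter `p`. -/
@[irreducible] noncomputable def mixtureRatio (p : ℝ≥0∞) (S N : ℕ) : ℝ≥0∞ :=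
  ((((N + 1) * N.choose S : ℕ) : ℝ≥0∞) * (p ^ S * (1 - p) ^ (N - S)))⁻¹

/-- Equality can fail at `a = 0`, where the left side is 0 · ∞ = 0. This is why the ratio is only a
supermartingale when `p` is 0 or 1. -/
theorem mul_inv_mul_le (a b : ℝ≥0∞) (ha : a ≠ ∞) : a * (b * a)⁻¹ ≤ b⁻¹ := by
  rcases eq_or_ne a 0 with rfl | h0
  · simp
  rw [ENNReal.mul_inv (Or.inr ha) (Or.inr h0), mul_comm, mul_assoc]
  exact (mul_le_mul_right (ENNReal.inv_mul_le_one a) b⁻¹).trans (mul_one _).le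

/-- Each term is a Beta integral, 1 / ((N+1) C(N,S)) = ∫ θ^S (1-θ)^(N-S) dθ over [0, 1]; the
identity is θ + (1-θ) = 1 under the integral. -/
theorem inv_choose_add_inv_choose {N S : ℕ} (hS : S ≤ N) :
    ((((N + 1 + 1) * (N + 1).choose (S + 1) : ℕ) : ℝ≥0∞))⁻¹ +
      ((((N + 1 + 1) * (N + 1).choose S : ℕ) : ℝ≥0∞))⁻¹ =
      ((((N + 1) * N.choose S : ℕ) : ℝ≥0∞))⁻¹ := by
  have h1 : 0 < (N + 1).choose (S + 1) := Nat.choose_pos (by omega)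
  have h2 : 0 < (N + 1).choose S := Nat.choose_pos (by omega)
  have h3 : 0 < N.choose S := Nat.choose_pos hS
  have e1 := Nat.add_one_mul_choose_eq N S
  have e2 := Nat.choose_mul_succ_eq N S
  obtain ⟨d, hd⟩ : ∃ d, N + 1 - S = d + 1 := ⟨N - S, by omega⟩
  have hN : N = S + d := by omega
  rw [hd] at e2
  generalize (N + 1).choose (S + 1) = A at *
  generalize (N + 1).choose S = B at *
  generalize N.choose S = C at *
  have cast (k : ℕ) (hk : 0 < k) : ((k : ℝ≥0∞))⁻¹ = ENNReal.ofReal ((k : ℝ)⁻¹) := by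
    rw [ENNReal.ofReal_inv_of_pos (by exact_mod_cast hk), ENNReal.ofReal_natCast]
  rw [cast _ (by positivity), cast _ (by positivity), cast _ (by positivity),
    ← ENNReal.ofReal_add (by positivity) (by positivity)]
  congr 1
  have f1 : ((N : ℝ) + 1) * C = A * (S + 1) := by exact_mod_cast e1
  have f2 : (C : ℝ) * (N + 1) = B * (d + 1) := by exact_mod_cast e2
  have hA : (0 : ℝ) < A := by exact_mod_cast h1
  have hB : (0 : ℝ) < B := by exact_mod_cast h2
  have hC : (0 : ℝ) < C := by exact_mod_cast h3
  have g1 : (A : ℝ) = (N + 1) * C / (S + 1) := by field_simp; linarith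
  have g2 : (B : ℝ) = (N + 1) * C / (d + 1) := by field_simp; linarith
  push_cast
  rw [g1, g2, hN]
  push_cast
  field_simp
  ring

/-- The one-step supermartingale property: the next point is an error with probability `p`. -/
theorem mixtureRatio_step {p : ℝ≥0∞} (hp : p ≤ 1) {S N : ℕ} (hS : S ≤ N) :
    p * mixtureRatio p (S + 1) (N + 1) + (1 - p) * mixtureRatio p S (N + 1) ≤
      mixtureRatio p S N := by
  have hp' : p ≠ ∞ := (hp.trans_lt ENNReal.one_lt_top).ne
  have hr' : 1 - p ≠ ∞ := ENNReal.sub_ne_top ENNReal.one_ne_top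
  unfold mixtureRatio
  set t := p ^ S * (1 - p) ^ (N - S) with ht
  have e1 : p ^ (S + 1) * (1 - p) ^ (N + 1 - (S + 1)) = t * p := by
    rw [ht, Nat.add_sub_add_right]; ring
  have e2 : p ^ S * (1 - p) ^ (N + 1 - S) = t * (1 - p) := by
    rw [ht, Nat.sub_add_comm hS]; ring
  have hinv (k : ℕ) (hk : k ≠ 0) : ((k : ℝ≥0∞) * t)⁻¹ = (k : ℝ≥0∞)⁻¹ * t⁻¹ :=
    ENNReal.mul_inv (Or.inl (by exact_mod_cast hk)) (Or.inl (ENNReal.natCast_ne_top k))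
  have h1 : (N + 1 + 1) * (N + 1).choose (S + 1) ≠ 0 :=
    mul_ne_zero (by omega) (Nat.choose_pos (by omega)).ne'
  have h2 : (N + 1 + 1) * (N + 1).choose S ≠ 0 :=
    mul_ne_zero (by omega) (Nat.choose_pos (by omega)).ne'
  have h3 : (N + 1) * N.choose S ≠ 0 := mul_ne_zero (by omega) (Nat.choose_pos hS).ne'
  have hsum := inv_choose_add_inv_choose hS
  rw [e1, e2]
  clear_value t
  generalize (N + 1 + 1) * (N + 1).choose (S + 1) = a at *
  generalize (N + 1 + 1) * (N + 1).choose S = b at *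
  generalize (N + 1) * N.choose S = c at *
  rw [← mul_assoc (a : ℝ≥0∞), ← mul_assoc (b : ℝ≥0∞)]
  refine (add_le_add (mul_inv_mul_le p (a * t) hp')
    (mul_inv_mul_le (1 - p) (b * t) hr')).trans ?_
  rw [hinv _ h1, hinv _ h2, hinv _ h3, ← add_mul, hsum]

theorem choose_mul_pow_le {u v : ℝ} (hu : 0 ≤ u) (hv : 0 ≤ v) {S N : ℕ} (hS : S ≤ N) :
    (N.choose S : ℝ) * (u ^ S * v ^ (N - S)) ≤ (u + v) ^ N := by
  rw [add_pow]
  refine le_trans (le_of_eq ?_) (Finset.single_le_sum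
    (f := fun k => u ^ k * v ^ (N - k) * (N.choose k : ℝ)) (fun k _ => by positivity)
    (Finset.mem_range.2 (Nat.lt_succ_of_le hS)))
  ring

/-- With Z = pA + (1-p)B, one binomial term is at most Z^N, and Z exp(-(Z-1)) ≤ 1. Replacing log Z
by Z - 1 makes the exponent affine in `S` and in `p`, so its posterior mean depends only on their
means and no joint convexity of D_ber is needed. -/
theorem exp_le_mixtureRatio {p A B : ℝ} (hp0 : 0 ≤ p) (hp1 : p ≤ 1) (hA : 0 < A) (hB : 0 < B)
    {S N : ℕ} (hS : S ≤ N) :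
    ENNReal.ofReal (Real.exp (S * Real.log A + (N - S : ℝ) * Real.log B -
      N * (p * A + (1 - p) * B - 1)) / (N + 1)) ≤ mixtureRatio (ENNReal.ofReal p) S N := by
  have hp1' : 0 ≤ 1 - p := sub_nonneg.2 hp1
  have hden : (((N + 1) * N.choose S : ℕ) : ℝ≥0∞) *
      (ENNReal.ofReal p ^ S * (1 - ENNReal.ofReal p) ^ (N - S)) =
      ENNReal.ofReal (((N + 1) * N.choose S : ℕ) * (p ^ S * (1 - p) ^ (N - S))) := by
    rw [ENNReal.ofReal_mul (by positivity), ENNReal.ofReal_mul (by positivity),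
      ENNReal.ofReal_pow hp0, ENNReal.ofReal_pow hp1', ENNReal.ofReal_sub _ hp0,
      ENNReal.ofReal_one, ENNReal.ofReal_natCast]
  rw [mixtureRatio, ENNReal.le_inv_iff_mul_le, hden, ← ENNReal.ofReal_mul (by positivity),
    ENNReal.ofReal_le_one]
  set Z := p * A + (1 - p) * B with hZ
  have hexp : Real.exp (S * Real.log A + (N - S : ℝ) * Real.log B - N * (Z - 1)) =
      A ^ S * B ^ (N - S) * Real.exp (-(Z - 1)) ^ N := by
    rw [← Real.exp_log hA, ← Real.exp_log hB, ← Real.exp_nat_mul, ← Real.exp_nat_mul,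
      ← Real.exp_nat_mul, ← Real.exp_add, ← Real.exp_add, Nat.cast_sub hS, Real.exp_log hA,
      Real.exp_log hB]
    congr 1
    ring
  have hZ0 : 0 ≤ Z := by positivity
  have hZe : Z * Real.exp (-(Z - 1)) ≤ 1 := by
    have : Z ≤ Real.exp (Z - 1) := by linarith [Real.add_one_le_exp (Z - 1)]
    calc Z * Real.exp (-(Z - 1)) ≤ Real.exp (Z - 1) * Real.exp (-(Z - 1)) := by gcongr
      _ = 1 := by rw [← Real.exp_add]; simp
  have hbin := choose_mul_pow_le (u := p * A) (v := (1 - p) * B) (by positivity) (by positivity) hS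
  rw [hexp]
  push_cast
  calc _ = (N.choose S : ℝ) * ((p * A) ^ S * ((1 - p) * B) ^ (N - S)) *
        Real.exp (-(Z - 1)) ^ N := by
        rw [mul_pow, mul_pow]; field_simp
    _ ≤ Z ^ N * Real.exp (-(Z - 1)) ^ N := by gcongr
    _ = (Z * Real.exp (-(Z - 1))) ^ N := (mul_pow _ _ _).symm
    _ ≤ 1 := pow_le_one₀ (by positivity) hZe

/-! ### The prior-averaged ratio as a supermartingale -/

section Supermartingale

variable {𝒲 𝒴 Ω : Type*}

open scoped Classical in
/-- The number of the first `N` data points in the error region of the parameter `w`. -/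
noncomputable def errorCount (E : Set (𝒲 × 𝒴)) (N : ℕ) (x : ℕ → 𝒴) (w : 𝒲) : ℕ :=
  ∑ j ∈ Finset.range N, if (w, x j) ∈ E then 1 else 0

theorem errorCount_le (E : Set (𝒲 × 𝒴)) (N : ℕ) (x : ℕ → 𝒴) (w : 𝒲) :
    errorCount E N x w ≤ N := by
  classical
  unfold errorCount
  refine (Finset.sum_le_sum (g := fun _ => 1) fun j _ => ?_).trans (by simp)
  split_ifs <;> simp

variable [MeasurableSpace 𝒲] [MeasurableSpace 𝒴]

/-- The probability of the error region of the parameter `w`. -/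
noncomputable def errorProb (E : Set (𝒲 × 𝒴)) (ν : Measure 𝒴) (w : 𝒲) : ℝ≥0∞ :=
  ν (Prod.mk w ⁻¹' E)

/-- The likelihood ratio `mixtureRatio`, averaged over the prior. -/
noncomputable def averagedRatio (E : Set (𝒲 × 𝒴)) (ν : Measure 𝒴) (P : Measure 𝒲) (N : ℕ)
    (x : ℕ → 𝒴) : ℝ≥0∞ :=
  ∫⁻ w, mixtureRatio (errorProb E ν w) (errorCount E N x w) N ∂P

theorem measurable_errorProb {E : Set (𝒲 × 𝒴)} (hE : MeasurableSet E) (ν : Measure 𝒴)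
    [SFinite ν] : Measurable (errorProb E ν) :=
  measurable_measure_prodMk_left hE

theorem measurable_errorCount [MeasurableSpace Ω] {E : Set (𝒲 × 𝒴)} (hE : MeasurableSet E)
    {X : ℕ → Ω → 𝒴} {N : ℕ} (hX : ∀ j < N, Measurable (X j)) :
    Measurable fun q : 𝒲 × Ω => errorCount E N (fun j => X j q.2) q.1 := by
  classical
  unfold errorCount
  refine Finset.measurable_sum _ fun j hj => ?_
  refine Measurable.ite ?_ measurable_const measurable_const
  exact (measurable_fst.prodMk ((hX j (Finset.mem_range.1 hj)).comp measurable_snd)) hE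

theorem measurable_mixtureRatio_left (S N : ℕ) :
    Measurable fun p : ℝ≥0∞ => mixtureRatio p S N := by
  unfold mixtureRatio
  generalize (((N + 1) * N.choose S : ℕ) : ℝ≥0∞) = b
  exact (((measurable_id.pow_const S).mul
    ((measurable_const.sub measurable_id).pow_const (N - S))).const_mul b).inv

theorem measurable_mixtureRatio_uncurry (N : ℕ) :
    Measurable fun q : ℝ≥0∞ × ℕ => mixtureRatio q.1 q.2 N :=
  measurable_from_prod_countable_left fun S => measurable_mixtureRatio_left S N

theorem measurable_mixtureRatio {α : Type*} [MeasurableSpace α] {p : α → ℝ≥0∞} {S : α → ℕ}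
    (hp : Measurable p) (hS : Measurable S) (N : ℕ) :
    Measurable fun a => mixtureRatio (p a) (S a) N :=
  (measurable_mixtureRatio_uncurry N).comp (hp.prodMk hS)

theorem measurable_mixtureRatio_errorCount [MeasurableSpace Ω] {E : Set (𝒲 × 𝒴)}
    (hE : MeasurableSet E) (ν : Measure 𝒴) [SFinite ν] {X : ℕ → Ω → 𝒴} {N : ℕ}
    (hX : ∀ j < N, Measurable (X j)) :
    Measurable fun q : 𝒲 × Ω =>
      mixtureRatio (errorProb E ν q.1) (errorCount E N (fun j => X j q.2) q.1) N :=
  measurable_mixtureRatio ((measurable_errorProb hE ν).comp measurable_fst)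
    (measurable_errorCount hE hX) N

theorem measurable_averagedRatio [MeasurableSpace Ω] {E : Set (𝒲 × 𝒴)}
    (hE : MeasurableSet E) (ν : Measure 𝒴) [SFinite ν] (P : Measure 𝒲) [SFinite P]
    {X : ℕ → Ω → 𝒴} {N : ℕ} (hX : ∀ j < N, Measurable (X j)) :
    Measurable fun ω => averagedRatio E ν P N (fun j => X j ω) :=
  (measurable_mixtureRatio_errorCount hE ν hX).lintegral_prod_left'

/-- The filtration of the data points observed before each time. -/
def pastFiltration {mΩ : MeasurableSpace Ω} (X : ℕ → Ω → 𝒴) (hX : ∀ j, Measurable (X j)) :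
    Filtration ℕ mΩ where
  seq k := ⨆ j ∈ Set.Iio k, MeasurableSpace.comap (X j) inferInstance
  mono' _ _ hab := biSup_mono fun _ hj => lt_of_lt_of_le hj hab
  le' _ := iSup₂_le fun j _ => (hX j).comap_le

theorem measurable_pastFiltration {mΩ : MeasurableSpace Ω} (X : ℕ → Ω → 𝒴)
    (hX : ∀ j, Measurable (X j)) {j k : ℕ} (hjk : j < k) :
    Measurable[pastFiltration X hX k] (X j) := by
  have : MeasurableSpace.comap (X j) inferInstance ≤ pastFiltration X hX k :=
    le_biSup (f := fun j => MeasurableSpace.comap (X j) inferInstance) (Set.mem_Iio.2 hjk)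
  exact (comap_measurable (X j)).mono this le_rfl

theorem indep_pastFiltration {mΩ : MeasurableSpace Ω} {μ : Measure Ω} (X : ℕ → Ω → 𝒴)
    (hX : ∀ j, Measurable (X j)) (hindep : iIndepFun X μ) (k : ℕ) :
    Indep (pastFiltration X hX k) (MeasurableSpace.comap (X k) inferInstance) μ := by
  have h := indep_iSup_of_disjoint (m := fun j => MeasurableSpace.comap (X j) inferInstance)
    (μ := μ) (fun j => (hX j).comap_le) hindep (S := Set.Iio k) (T := {k}) (by simp)
  rwa [iSup_singleton] at h

/-- The supermartingale property for fixed `w`, tested on past events: the new point is independent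
of the past, so its indicator integrates out to `p` or `1 - p`. -/
theorem lintegral_mixtureRatio_succ_le {mΩ : MeasurableSpace Ω} {μ : Measure Ω}
    [IsProbabilityMeasure μ] {ν : Measure 𝒴} [IsProbabilityMeasure ν]
    {X : ℕ → Ω → 𝒴} (hX : ∀ j, Measurable (X j)) (hindep : iIndepFun X μ)
    (hlaw : ∀ j, μ.map (X j) = ν) {E : Set (𝒲 × 𝒴)} (hE : MeasurableSet E) (w : 𝒲) (k : ℕ)
    {B : Set Ω} (hB : MeasurableSet[pastFiltration X hX k] B) :
    ∫⁻ ω in B, mixtureRatio (errorProb E ν w) (errorCount E (k + 1) (fun j => X j ω) w) (k + 1) ∂μ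
      ≤ ∫⁻ ω in B, mixtureRatio (errorProb E ν w) (errorCount E k (fun j => X j ω) w) k ∂μ := by
  classical
  set p := errorProb E ν w with hp
  set c : Set 𝒴 := Prod.mk w ⁻¹' E with hc
  have hcm : MeasurableSet c := measurable_prodMk_left hE
  set S : Ω → ℕ := fun ω => errorCount E k (fun j => X j ω) w with hS
  have hle := (pastFiltration X hX).le k
  have hBm := hle _ hB
  have hSm : Measurable[pastFiltration X hX k] S :=
    (@measurable_errorCount 𝒲 𝒴 Ω _ _ (pastFiltration X hX k) E hE X k
      (fun j hj => measurable_pastFiltration X hX hj)).comp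
      (@measurable_prodMk_left 𝒲 Ω _ (pastFiltration X hX k) w)
  have hf (f : ℕ → ℝ≥0∞) : Measurable[pastFiltration X hX k] (B.indicator fun ω => f (S ω)) :=
    Measurable.indicator (measurable_from_nat.comp hSm) hB
  have hind (f : ℕ → ℝ≥0∞) (d : Set 𝒴) (hd : MeasurableSet d) :
      ∫⁻ ω in B, f (S ω) * (X k ⁻¹' d).indicator 1 ω ∂μ = ν d * ∫⁻ ω in B, f (S ω) ∂μ := by
    have h := lintegral_mul_eq_lintegral_mul_lintegral_of_independent_measurableSpace hle
      (hX k).comap_le (indep_pastFiltration X hX hindep k) (hf f)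
      (g := (X k ⁻¹' d).indicator 1)
      (Measurable.indicator measurable_const ⟨d, hd, rfl⟩)
    rw [lintegral_indicator hBm, lintegral_indicator_one (hX k hd), ← Measure.map_apply (hX k) hd,
      hlaw, mul_comm] at h
    rw [← h, ← lintegral_indicator hBm]
    refine lintegral_congr fun ω => ?_
    by_cases hω : ω ∈ B <;> simp [hω]
  have hsucc ω : mixtureRatio p (errorCount E (k + 1) (fun j => X j ω) w) (k + 1) =
      mixtureRatio p (S ω + 1) (k + 1) * (X k ⁻¹' c).indicator 1 ω +
        mixtureRatio p (S ω) (k + 1) * (X k ⁻¹' cᶜ).indicator 1 ω := by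
    have : errorCount E (k + 1) (fun j => X j ω) w = S ω + if (w, X k ω) ∈ E then 1 else 0 := by
      rw [hS, errorCount, Finset.sum_range_succ]
      rfl
    rw [this]
    by_cases h : (w, X k ω) ∈ E <;> simp [hc, h]
  have hmeas (f : ℕ → ℝ≥0∞) : Measurable fun ω => f (S ω) :=
    (measurable_from_nat.comp hSm).mono hle le_rfl
  have hcp : ν c = p := rfl
  have hp1 : p ≤ 1 := prob_le_one
  calc _ = ∫⁻ ω in B, (mixtureRatio p (S ω + 1) (k + 1) * (X k ⁻¹' c).indicator 1 ω +
        mixtureRatio p (S ω) (k + 1) * (X k ⁻¹' cᶜ).indicator 1 ω) ∂μ := by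
        simp_rw [hsucc]
    _ = p * ∫⁻ ω in B, mixtureRatio p (S ω + 1) (k + 1) ∂μ +
        (1 - p) * ∫⁻ ω in B, mixtureRatio p (S ω) (k + 1) ∂μ := by
        rw [lintegral_add_left, hind (fun s => mixtureRatio p (s + 1) (k + 1)) c hcm,
          hind (fun s => mixtureRatio p s (k + 1)) cᶜ hcm.compl, prob_compl_eq_one_sub hcm, hcp]
        exact (hmeas fun s => mixtureRatio p (s + 1) (k + 1)).mul
          (measurable_one.indicator (hX k hcm))
    _ = ∫⁻ ω in B, (p * mixtureRatio p (S ω + 1) (k + 1) +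
        (1 - p) * mixtureRatio p (S ω) (k + 1)) ∂μ := by
        rw [lintegral_add_left ((hmeas fun s => mixtureRatio p (s + 1) (k + 1)).const_mul p),
          lintegral_const_mul _ (hmeas fun s => mixtureRatio p (s + 1) (k + 1)),
          lintegral_const_mul _ (hmeas fun s => mixtureRatio p s (k + 1))]
    _ ≤ _ := lintegral_mono fun ω => mixtureRatio_step hp1 (errorCount_le E k _ w)

/-- Tonelli carries the supermartingale property from fixed `w` to the prior average; with no data
the ratio equals 1. -/
theorem measure_averagedRatio_ge_le {mΩ : MeasurableSpace Ω} {μ : Measure Ω}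
    [IsProbabilityMeasure μ] {ν : Measure 𝒴} [IsProbabilityMeasure ν]
    (P : Measure 𝒲) [IsProbabilityMeasure P]
    {X : ℕ → Ω → 𝒴} (hX : ∀ j, Measurable (X j)) (hindep : iIndepFun X μ)
    (hlaw : ∀ j, μ.map (X j) = ν) {E : Set (𝒲 × 𝒴)} (hE : MeasurableSet E) (c : ℝ≥0∞) :
    c * μ {ω | ∃ k, c ≤ averagedRatio E ν P k (fun j => X j ω)} ≤ 1 := by
  refine (ville_inequality μ (pastFiltration X hX)
    (fun k ω => averagedRatio E ν P k (fun j => X j ω)) (fun k => ?_) (fun k B hB => ?_) c).trans ?_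
  · exact @measurable_averagedRatio 𝒲 𝒴 Ω _ _ (pastFiltration X hX k) E hE ν _ P _ X k
      fun j hj => measurable_pastFiltration X hX hj
  · have hm (k : ℕ) := measurable_mixtureRatio_errorCount hE ν (N := k) fun j _ => hX j
    unfold averagedRatio
    rw [lintegral_lintegral_swap
      (f := fun ω w =>
        mixtureRatio (errorProb E ν w) (errorCount E (k + 1) (fun j => X j ω) w) (k + 1))
      ((hm (k + 1)).comp measurable_swap).aemeasurable,
      lintegral_lintegral_swap
      (f := fun ω w => mixtureRatio (errorProb E ν w) (errorCount E k (fun j => X j ω) w) k)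
      ((hm k).comp measurable_swap).aemeasurable]
    exact lintegral_mono fun w => lintegral_mixtureRatio_succ_le hX hindep hlaw hE w k hB
  · simp [averagedRatio, mixtureRatio, errorCount]

end Supermartingale

/-! ### The PAC-Bayes inequality -/

section PACBayes

variable {𝒲 𝒴 : Type*} [MeasurableSpace 𝒲] [MeasurableSpace 𝒴]

/-- The Donsker-Varadhan inequality. -/
theorem integral_le_toReal_klDiv_add_log {P Q : Measure 𝒲} [IsProbabilityMeasure P]
    [IsProbabilityMeasure Q] (hKL : InformationTheory.klDiv Q P ≠ ∞) {g : 𝒲 → ℝ}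
    (hg : Integrable g Q) (hexp : Integrable (fun w => Real.exp (g w)) P) :
    ∫ w, g w ∂Q ≤ (InformationTheory.klDiv Q P).toReal + Real.log (∫ w, Real.exp (g w) ∂P) := by
  obtain ⟨hac, hllr⟩ := InformationTheory.klDiv_ne_top_iff.1 hKL
  have := isProbabilityMeasure_tilted hexp
  have hac' : Q ≪ P.tilted g := hac.trans (absolutelyContinuous_tilted hexp)
  have h1 := integral_llr_tilted_right hac hg hexp hllr
  have h2 := InformationTheory.toReal_klDiv_of_measure_eq hac' (by simp)
  -- The gap in the inequality is the divergence of `Q` from the tilted prior, which is nonnegative.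
  have h3 := InformationTheory.toReal_klDiv_of_measure_eq hac (by simp)
  have h4 : 0 ≤ (InformationTheory.klDiv Q (P.tilted g)).toReal := ENNReal.toReal_nonneg
  linarith

/-- Donsker-Varadhan applied to the exponent of `exp_le_mixtureRatio`, with `A` and `B` the ratios
of the Bernoulli parameters `a` and `p`. The free `a` keeps both logarithms finite when `q` is 0 or
1. -/
theorem posterior_risk_le_of_averagedRatio_lt {P Q : Measure 𝒲} [IsProbabilityMeasure P]
    [IsProbabilityMeasure Q] {ν : Measure 𝒴} [IsProbabilityMeasure ν]
    (hKL : InformationTheory.klDiv Q P ≠ ∞) {E : Set (𝒲 × 𝒴)} (hE : MeasurableSet E)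
    {x : ℕ → 𝒴} {N : ℕ} (hN : 0 < N) {δ : ℝ} (hδ : 0 < δ)
    (hx : averagedRatio E ν P N x < (ENNReal.ofReal δ)⁻¹) {q p a : ℝ}
    (hq : ∫ w, (errorCount E N x w : ℝ) / N ∂Q = q) (hp : ∫ w, (errorProb E ν w).toReal ∂Q = p)
    (hp0 : 0 < p) (hp1 : p < 1) (ha0 : 0 < a) (ha1 : a < 1) :
    N * (q * Real.log (a / p) + (1 - q) * Real.log ((1 - a) / (1 - p))) ≤
      (InformationTheory.klDiv Q P).toReal + Real.log ((N + 1) / δ) := by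
  have hp1' : 0 < 1 - p := by linarith
  have ha1' : 0 < 1 - a := by linarith
  set A := a / p with hA
  set B := (1 - a) / (1 - p) with hB
  have hA0 : 0 < A := by positivity
  have hB0 : 0 < B := by positivity
  set r : 𝒲 → ℝ := fun w => (errorProb E ν w).toReal with hr
  have hrm : Measurable r := (measurable_errorProb hE ν).ennreal_toReal
  have hr0 w : 0 ≤ r w := ENNReal.toReal_nonneg
  have hr1 w : r w ≤ 1 := measureReal_le_one
  set s : 𝒲 → ℝ := fun w => (errorCount E N x w : ℝ) with hs
  have hsm : Measurable s := by
    have h := (measurable_errorCount (Ω := Unit) hE (X := fun j _ => x j) (N := N)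
      (fun j _ => measurable_const)).comp (measurable_prodMk_right (y := ()))
    exact (measurable_from_nat (f := fun k : ℕ => (k : ℝ))).comp h
  have hs0 w : 0 ≤ s w := Nat.cast_nonneg _
  have hsN w : s w ≤ N := Nat.cast_le.2 (errorCount_le E N x w)
  have hN' : (0 : ℝ) < N := by exact_mod_cast hN
  have hsint (R : Measure 𝒲) [IsProbabilityMeasure R] : Integrable s R :=
    Integrable.of_bound hsm.aestronglyMeasurable (N : ℝ) (ae_of_all _ fun w => by
      rw [Real.norm_of_nonneg (hs0 w)]; exact hsN w)
  have hrint (R : Measure 𝒲) [IsProbabilityMeasure R] : Integrable r R :=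
    Integrable.of_bound hrm.aestronglyMeasurable 1 (ae_of_all _ fun w => by
      rw [Real.norm_of_nonneg (hr0 w)]; exact hr1 w)
  set g : 𝒲 → ℝ := fun w => s w * Real.log A + (N - s w) * Real.log B -
    N * (r w * A + (1 - r w) * B - 1) with hg
  have hg' : g = fun w => s w * (Real.log A - Real.log B) - r w * (N * (A - B)) +
      (N * Real.log B - N * (B - 1)) := by
    funext w; simp only [hg]; ring
  have hgm : Measurable g := by rw [hg']; fun_prop
  have hgint : Integrable g Q := by
    rw [hg']
    exact (((hsint Q).mul_const _).sub ((hrint Q).mul_const _)).add (integrable_const _)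
  have hgQ : ∫ w, g w ∂Q = N * (q * Real.log A + (1 - q) * Real.log B) := by
    have hsq : ∫ w, s w ∂Q = N * q := by
      rw [← hq, integral_div, mul_div_cancel₀ _ hN'.ne']
    -- Since `p` is the posterior mean of `r`, the linear correction in `g` integrates to zero.
    have hzero : p * A + (1 - p) * B = 1 := by
      rw [hA, hB]; field_simp; ring
    simp only [hg']
    rw [integral_add (by exact ((hsint Q).mul_const _).sub ((hrint Q).mul_const _))
      (integrable_const _), integral_sub ((hsint Q).mul_const _) ((hrint Q).mul_const _),
      integral_mul_const, integral_mul_const, hsq, hp, integral_const]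
    simp only [probReal_univ, one_smul]
    linear_combination -(N : ℝ) * hzero
  have hlint : ∫⁻ w, ENNReal.ofReal (Real.exp (g w) / (N + 1)) ∂P ≤ ENNReal.ofReal δ⁻¹ := by
    rw [ENNReal.ofReal_inv_of_pos hδ]
    refine le_trans (lintegral_mono fun w => ?_) hx.le
    have h := exp_le_mixtureRatio (hr0 w) (hr1 w) hA0 hB0 (errorCount_le E N x w)
    rwa [show ENNReal.ofReal (r w) = errorProb E ν w from
      ENNReal.ofReal_toReal (measure_ne_top ν _)] at h
  have hpos w : 0 ≤ Real.exp (g w) / (N + 1) := by positivity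
  have hexpint' : Integrable (fun w => Real.exp (g w) / (N + 1)) P :=
    ⟨by fun_prop, by
      rw [hasFiniteIntegral_iff_ofReal (ae_of_all _ hpos)]
      exact hlint.trans_lt ENNReal.ofReal_lt_top⟩
  have hexpint : Integrable (fun w => Real.exp (g w)) P := by
    refine (hexpint'.mul_const ((N : ℝ) + 1)).congr (ae_of_all _ fun w => ?_)
    simp only
    field_simp
  have hbound : ∫ w, Real.exp (g w) ∂P ≤ (N + 1) / δ := by
    rw [← ofReal_integral_eq_lintegral_ofReal hexpint' (ae_of_all _ hpos),
      ENNReal.ofReal_le_ofReal_iff (by positivity), integral_div,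
      div_le_iff₀ (by positivity)] at hlint
    rwa [div_eq_inv_mul]
  rw [← hgQ]
  refine (integral_le_toReal_klDiv_add_log hKL hgint hexpint).trans ?_
  gcongr
  exact integral_exp_pos hexpint

end PACBayes

/-- The choice `a = q` gives the claim for interior `q`; the endpoints are reached by letting `a`
tend to `q`. -/
theorem bernoulliKL_le_of_forall {q p D : ℝ} (hq0 : 0 ≤ q) (hq1 : q ≤ 1) (hp0 : 0 < p)
    (hp1 : p < 1)
    (h : ∀ a ∈ Set.Ioo (0 : ℝ) 1,
      q * Real.log (a / p) + (1 - q) * Real.log ((1 - a) / (1 - p)) ≤ D) :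
    bernoulliKL q p ≤ D := by
  have hp1' : 1 - p ≠ 0 := by linarith
  rcases hq0.eq_or_lt with rfl | hq0
  · have hc : Filter.Tendsto (fun a : ℝ => Real.log ((1 - a) / (1 - p))) (nhdsWithin 0 (Set.Ioi 0))
        (nhds (Real.log ((1 - 0) / (1 - p)))) :=
      (ContinuousAt.tendsto (by fun_prop (disch := simp [hp1']))).mono_left nhdsWithin_le_nhds
    have := le_of_tendsto hc (b := D) (by
      filter_upwards [Ioo_mem_nhdsGT (zero_lt_one' ℝ)] with a ha
      simpa using h a ha)
    simpa [bernoulliKL] using this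
  · rcases hq1.eq_or_lt with rfl | hq1
    · have hc : Filter.Tendsto (fun a : ℝ => Real.log (a / p)) (nhdsWithin 1 (Set.Iio 1))
          (nhds (Real.log (1 / p))) :=
        (ContinuousAt.tendsto (by fun_prop (disch := simp [hp0.ne']))).mono_left nhdsWithin_le_nhds
      have := le_of_tendsto hc (b := D) (by
        filter_upwards [Ioo_mem_nhdsLT (zero_lt_one' ℝ)] with a ha
        simpa using h a ha)
      simpa [bernoulliKL] using this
    · exact h q ⟨hq0, hq1⟩

/-! ### Gaussian weights and their marginals -/

variable {n : ℕ}

theorem posDef_momentMatrix (m : ℕ) {σ₀ : ℝ} (hσ₀ : 0 < σ₀) (N : ℕ) (x : ℕ → Fin n → ℝ) :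
    (momentMatrix m σ₀ N x).PosDef := by
  unfold momentMatrix
  refine Matrix.PosDef.add_posSemidef (Matrix.PosDef.one.smul (by positivity)) ?_
  refine Matrix.PosSemidef.smul (Matrix.posSemidef_sum _ fun j _ => ?_) (by positivity)
  simpa using Matrix.posSemidef_vecMulVec_self_star (monomialVec m (x j))

theorem map_dotProduct_multivariateGaussian {ι : Type*} [Fintype ι] [DecidableEq ι]
    {S : Matrix ι ι ℝ} (hS : S.PosSemidef) (z : ι → ℝ) :
    (multivariateGaussian 0 S).map (fun w : EuclideanSpace ℝ ι => (w : ι → ℝ) ⬝ᵥ z) =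
      gaussianReal 0 (z ⬝ᵥ S.mulVec z).toNNReal := by
  have hfun : (fun w : EuclideanSpace ℝ ι => (w : ι → ℝ) ⬝ᵥ z) =
      innerSL ℝ (WithLp.toLp 2 z) := by
    funext w
    simp [EuclideanSpace.inner_eq_star_dotProduct]
  have hmean : ∫ w, innerSL ℝ (WithLp.toLp 2 z) w ∂(multivariateGaussian 0 S) = 0 := by
    rw [ContinuousLinearMap.integral_comp_id_comm IsGaussian.integrable_id,
      integral_id_multivariateGaussian, map_zero]
  have hvar : Var[innerSL ℝ (WithLp.toLp 2 z); multivariateGaussian 0 S] = z ⬝ᵥ S.mulVec z := by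
    rw [← covarianceBilin_multivariateGaussian (μ := 0) hS (WithLp.toLp 2 z) (WithLp.toLp 2 z),
      covarianceBilin_self IsGaussian.memLp_two_id]
    rfl
  rw [hfun, IsGaussian.map_eq_gaussianReal, hmean, hvar]

/-- A variable of variance `v` is √v times a standard one `z`, and z² > 1 forces v z² > v > η. -/
theorem gaussianReal_sq_gt_ge {v η : ℝ} (hη : 0 < η) (hv : η < v) :
    ENNReal.ofReal (1 - chiSqCDF 1) ≤ gaussianReal 0 v.toNNReal {t | ¬ t ^ 2 ≤ η} := by
  have hv0 : 0 < v := hη.trans hv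
  have h := gaussianReal_map_const_mul (μ := 0) (v := 1) (Real.sqrt v)
  have hvar : (.mk (Real.sqrt v ^ 2) (sq_nonneg _) * 1 : NNReal) = v.toNNReal := by
    ext
    simp [Real.sq_sqrt hv0.le, hv0.le]
  rw [hvar, mul_zero] at h
  have hm1 : MeasurableSet {z : ℝ | z ^ 2 ≤ 1} := measurableSet_le (by fun_prop) (by fun_prop)
  have hm2 : MeasurableSet {z : ℝ | ¬ z ^ 2 ≤ η} :=
    (measurableSet_le (f := fun z : ℝ => z ^ 2) (by fun_prop) measurable_const).compl
  rw [← h, Measure.map_apply (by fun_prop) hm2, chiSqCDF, ← probReal_compl_eq_one_sub hm1,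
    ofReal_measureReal]
  refine measure_mono fun z hz => ?_
  simp only [Set.mem_compl_iff, Set.mem_ofPred_eq, not_le, Set.mem_preimage, mul_pow,
    Real.sq_sqrt hv0.le] at hz ⊢
  nlinarith

theorem gaussianReal_sq_le_pos (v : NNReal) {η : ℝ} (hη : 0 < η) :
    0 < gaussianReal 0 v {t | t ^ 2 ≤ η} := by
  rcases eq_or_ne v 0 with rfl | hv
  · rw [gaussianReal_zero_var, Measure.dirac_apply_of_mem]
    · exact zero_lt_one
    · simpa using hη.le
  · refine pos_iff_ne_zero.2 fun h => ?_
    have h0 := gaussianReal_absolutelyContinuous' 0 hv h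
    have hopen : IsOpen {t : ℝ | t ^ 2 < η} := isOpen_lt (by fun_prop) (by fun_prop)
    refine (hopen.measure_pos volume ⟨0, by simpa using hη⟩).ne'
      (measure_mono_null (fun t ht => ?_) h0)
    exact le_of_lt (a := t ^ 2) ht

theorem chiSqCDF_one_lt_one : chiSqCDF 1 < 1 := by
  have hm : MeasurableSet {z : ℝ | z ^ 2 ≤ 1} := measurableSet_le (by fun_prop) (by fun_prop)
  have : 0 < (gaussianReal 0 1).real {z : ℝ | z ^ 2 ≤ 1}ᶜ := by
    refine ENNReal.toReal_pos (fun h => ?_) (measure_ne_top _ _)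
    have h0 := gaussianReal_absolutelyContinuous' 0 one_ne_zero h
    have hopen : IsOpen {t : ℝ | 1 < t ^ 2} := isOpen_lt (by fun_prop) (by fun_prop)
    refine (hopen.measure_pos volume ⟨2, by norm_num⟩).ne' (measure_mono_null (fun t ht => ?_) h0)
    exact not_le.2 (show 1 < t ^ 2 from ht)
  rw [probReal_compl_eq_one_sub hm] at this
  exact sub_pos.1 this

/-- The pairs of a weight vector and a data point outside of its concept. -/
def errorSet (n m : ℕ) (η : ℝ) : Set (EuclideanSpace ℝ (MonoIdx n m) × (Fin n → ℝ)) :=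
  {q | ¬ ((q.1 : MonoIdx n m → ℝ) ⬝ᵥ monomialVec m q.2) ^ 2 ≤ η}

theorem continuous_monomialVec (m : ℕ) : Continuous (monomialVec (n := n) m) := by
  unfold monomialVec
  fun_prop

theorem measurableSet_errorSet (m : ℕ) (η : ℝ) : MeasurableSet (errorSet n m η) := by
  have h : Continuous fun q : EuclideanSpace ℝ (MonoIdx n m) × (Fin n → ℝ) =>
      ((q.1 : MonoIdx n m → ℝ) ⬝ᵥ monomialVec m q.2) ^ 2 := by
    have := continuous_monomialVec (n := n) m
    unfold dotProduct
    fun_prop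
  exact (measurableSet_le h.measurable measurable_const).compl

variable (m : ℕ) {σ₀ η : ℝ} (N : ℕ) (x : ℕ → Fin n → ℝ)

instance : IsProbabilityMeasure (prior n m σ₀) := by unfold prior; infer_instance

instance : IsProbabilityMeasure (posterior m σ₀ N x) := by unfold posterior; infer_instance

theorem map_dotProduct_posterior (hσ₀ : 0 < σ₀) (y : Fin n → ℝ) :
    (posterior m σ₀ N x).map
        (fun w : EuclideanSpace ℝ (MonoIdx n m) => (w : MonoIdx n m → ℝ) ⬝ᵥ monomialVec m y) =
      gaussianReal 0 (invChristoffel m σ₀ N x y).toNNReal :=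
  map_dotProduct_multivariateGaussian (posDef_momentMatrix m hσ₀ N x).inv.posSemidef _

theorem posterior_errorSet_eq (hσ₀ : 0 < σ₀) (y : Fin n → ℝ) :
    posterior m σ₀ N x ((fun w => (w, y)) ⁻¹' errorSet n m η) =
      gaussianReal 0 (invChristoffel m σ₀ N x y).toNNReal {t | ¬ t ^ 2 ≤ η} := by
  rw [← map_dotProduct_posterior m N x hσ₀ y, Measure.map_apply]
  · rfl
  · unfold dotProduct
    fun_prop
  · exact (measurableSet_le (f := fun t : ℝ => t ^ 2) (by fun_prop) measurable_const).compl

theorem posterior_errorSet_lt_one (hσ₀ : 0 < σ₀) (hη : 0 < η) (y : Fin n → ℝ) :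
    posterior m σ₀ N x ((fun w => (w, y)) ⁻¹' errorSet n m η) < 1 := by
  rw [posterior_errorSet_eq m N x hσ₀ y]
  have hm : MeasurableSet {t : ℝ | t ^ 2 ≤ η} := measurableSet_le (by fun_prop) (by fun_prop)
  rw [show {t : ℝ | ¬ t ^ 2 ≤ η} = {t | t ^ 2 ≤ η}ᶜ from rfl, prob_compl_eq_one_sub hm]
  exact ENNReal.sub_lt_self ENNReal.one_ne_top one_ne_zero (gaussianReal_sq_le_pos _ hη).ne'

/-! ### Stochastic risk and the Christoffel sublevel set -/

/-- The stochastic risk `E_{c ∼ Q} P(X ∉ c)` of the posterior. -/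
noncomputable def stochRisk (PX : Measure (Fin n → ℝ)) (m : ℕ) (σ₀ η : ℝ) (N : ℕ)
    (x : ℕ → Fin n → ℝ) : ℝ :=
  ∫ w, (errorProb (errorSet n m η) PX w).toReal ∂(posterior m σ₀ N x)

theorem stochRisk_nonneg (PX : Measure (Fin n → ℝ)) : 0 ≤ stochRisk PX m σ₀ η N x :=
  integral_nonneg fun _ => ENNReal.toReal_nonneg

variable (PX : Measure (Fin n → ℝ)) [IsProbabilityMeasure PX]

theorem ofReal_stochRisk :
    ENNReal.ofReal (stochRisk PX m σ₀ η N x) =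
      ∫⁻ y, posterior m σ₀ N x ((fun w => (w, y)) ⁻¹' errorSet n m η) ∂PX := by
  have hE := measurableSet_errorSet (n := n) m η
  have hm := measurable_errorProb hE PX
  have hlt : ∫⁻ w, errorProb (errorSet n m η) PX w ∂(posterior m σ₀ N x) < ∞ :=
    (lintegral_mono fun w => prob_le_one).trans_lt (by simp)
  rw [stochRisk, integral_toReal hm.aemeasurable (ae_of_all _ fun w => measure_lt_top PX _),
    ENNReal.ofReal_toReal hlt.ne]
  exact (Measure.prod_apply hE).symm.trans (Measure.prod_apply_symm hE)

/-- Every centred Gaussian, even a degenerate one, charges t² ≤ η. Strictness makes the risk an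
admissible β in the supremum over the open interval. -/
theorem stochRisk_lt_one (hσ₀ : 0 < σ₀) (hη : 0 < η) : stochRisk PX m σ₀ η N x < 1 := by
  rw [← ENNReal.ofReal_lt_one, ofReal_stochRisk]
  have h1 : (1 : ℝ≥0∞) = ∫⁻ _, 1 ∂PX := by simp
  rw [h1]
  refine lintegral_strict_mono (IsProbabilityMeasure.ne_zero PX) aemeasurable_const ?_
    (ae_of_all _ fun y => posterior_errorSet_lt_one m N x hσ₀ hη y)
  rw [← ofReal_stochRisk]
  exact ENNReal.ofReal_ne_top

theorem continuous_invChristoffel : Continuous (invChristoffel m σ₀ N x) := by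
  have := continuous_monomialVec (n := n) m
  unfold invChristoffel Matrix.mulVec dotProduct
  fun_prop

/-- A Markov-type bound: after Tonelli, the integrand is at least 1 - F₁(1) wherever C(y) > η. -/
theorem le_stochRisk (hσ₀ : 0 < σ₀) (hη : 0 < η) :
    (1 - chiSqCDF 1) * PX.real {y | ¬ invChristoffel m σ₀ N x y ≤ η} ≤
      stochRisk PX m σ₀ η N x := by
  have hm : MeasurableSet {y | ¬ invChristoffel m σ₀ N x y ≤ η} :=
    (measurableSet_le (continuous_invChristoffel m N x).measurable measurable_const).compl
  rw [← ENNReal.ofReal_le_ofReal_iff (stochRisk_nonneg m N x PX), ofReal_stochRisk,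
    ENNReal.ofReal_mul (by linarith [chiSqCDF_one_lt_one]), ofReal_measureReal,
    ← setLIntegral_const]
  refine (setLIntegral_mono' hm fun y hy => ?_).trans (setLIntegral_le_lintegral _ _)
  rw [posterior_errorSet_eq m N x hσ₀ y]
  exact gaussianReal_sq_gt_ge hη (not_le.1 hy)

theorem empStochRisk_eq :
    empStochRisk m σ₀ η N x =
      ∫ w, (errorCount (errorSet n m η) N x w : ℝ) / N ∂(posterior m σ₀ N x) := by
  classical
  refine integral_congr_ae (ae_of_all _ fun w => ?_)
  simp only [errorCount, Nat.cast_sum]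
  rw [one_div, inv_mul_eq_div]
  congr 1
  refine Finset.sum_congr rfl fun j _ => ?_
  by_cases h : (w, x j) ∈ errorSet n m η
  · rw [if_pos h, loss, Set.indicator_of_mem]
    · simp
    · exact h
  · rw [if_neg h, loss, Set.indicator_of_notMem]
    · simp
    · exact h

theorem empStochRisk_mem_Icc : empStochRisk m σ₀ η N x ∈ Set.Icc (0 : ℝ) 1 := by
  rw [empStochRisk_eq]
  have hle w : (errorCount (errorSet n m η) N x w : ℝ) / N ≤ 1 :=
    div_le_one_of_le₀ (Nat.cast_le.2 (errorCount_le _ N x w)) (Nat.cast_nonneg _)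
  refine ⟨integral_nonneg fun w => by positivity, ?_⟩
  refine (integral_mono_of_nonneg (ae_of_all _ fun w => by positivity) (integrable_const 1)
    (ae_of_all _ hle)).trans (by simp)

theorem riskBound_nonneg (δ : ℝ) : 0 ≤ riskBound m σ₀ η δ N x :=
  Real.sSup_nonneg fun _ hβ => hβ.1.1.le

theorem le_riskBound_of_mem {δ β : ℝ} (hβ : β ∈ Set.Ioo (0 : ℝ) 1)
    (h : ENNReal.ofReal (bernoulliKL (empStochRisk m σ₀ η N x) β) ≤ complexityTerm m σ₀ δ N x) :
    β ≤ riskBound m σ₀ η δ N x :=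
  le_csSup ⟨1, fun _ hb => hb.1.2.le⟩ ⟨hβ, h⟩

/-! ### From the good event to the accuracy guarantee -/

variable {N} {x} {PX}

theorem stochRisk_le_riskBound (hσ₀ : 0 < σ₀) (hη : 0 < η) (hN : 0 < N) {δ : ℝ}
    (hδ : δ ∈ Set.Ioo (0 : ℝ) 1)
    (hx : averagedRatio (errorSet n m η) PX (prior n m σ₀) N x < (ENNReal.ofReal δ)⁻¹) :
    stochRisk PX m σ₀ η N x ≤ riskBound m σ₀ η δ N x := by
  -- Zero risk is not an admissible β; nonnegativity of the supremum covers it, also for an empty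
  -- set.
  rcases (stochRisk_nonneg (σ₀ := σ₀) (η := η) m N x PX).eq_or_lt with h0 | h0
  · rw [← h0]
    exact riskBound_nonneg m N x δ
  have h1 := stochRisk_lt_one m N x PX hσ₀ hη
  refine le_riskBound_of_mem m N x ⟨h0, h1⟩ ?_
  have hN' : (0 : ℝ) < N := by exact_mod_cast hN
  rw [complexityTerm, ENNReal.le_div_iff_mul_le (Or.inl (by exact_mod_cast hN.ne'))
    (Or.inl (ENNReal.natCast_ne_top N))]
  -- Infinite divergence makes the constraint on β vacuous.
  rcases eq_or_ne (InformationTheory.klDiv (posterior m σ₀ N x) (prior n m σ₀)) ∞ with hKL | hKL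
  · simp [hKL]
  obtain ⟨hq0, hq1⟩ := empStochRisk_mem_Icc (σ₀ := σ₀) (η := η) m N x
  have hkl : bernoulliKL (empStochRisk m σ₀ η N x) (stochRisk PX m σ₀ η N x) ≤
      ((InformationTheory.klDiv (posterior m σ₀ N x) (prior n m σ₀)).toReal +
        Real.log ((N + 1) / δ)) / N := by
    refine bernoulliKL_le_of_forall hq0 hq1 h0 h1 fun a ha => ?_
    rw [le_div_iff₀' hN']
    exact posterior_risk_le_of_averagedRatio_lt hKL (measurableSet_errorSet m η) hN hδ.1 hx
      (empStochRisk_eq m N x).symm rfl h0 h1 ha.1 ha.2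
  rw [le_div_iff₀ hN'] at hkl
  rw [← ENNReal.ofReal_natCast, ← ENNReal.ofReal_mul' hN'.le, ← ENNReal.ofReal_toReal hKL]
  exact (ENNReal.ofReal_le_ofReal hkl).trans ENNReal.ofReal_add_le

variable (N₀ Nb : ℕ)

theorem one_sub_accuracy_le (hσ₀ : 0 < σ₀) (hη : 0 < η) (hNb : 0 < Nb) {δ : ℝ}
    (hδ : δ ∈ Set.Ioo (0 : ℝ) 1) {𝒳 : Set (Fin n → ℝ)} (h𝒳 : ∀ᵐ y ∂PX, y ∈ 𝒳)
    (hx : ∀ N, averagedRatio (errorSet n m η) PX (prior n m σ₀) N x < (ENNReal.ofReal δ)⁻¹)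
    {i : ℕ} (hi : 1 ≤ i) :
    1 - accuracy m σ₀ η δ N₀ Nb x i ≤ PX.real (estimate 𝒳 m σ₀ η N₀ Nb x i) := by
  obtain ⟨k, rfl⟩ : ∃ k, i = k + 1 := ⟨i - 1, by omega⟩
  set N := sampleSize N₀ Nb (k + 1) with hN
  have hNpos : 0 < N := by rw [hN, sampleSize]; omega
  have hF : 0 < 1 - chiSqCDF 1 := sub_pos.2 chiSqCDF_one_lt_one
  have hest : PX.real (estimate 𝒳 m σ₀ η N₀ Nb x (k + 1)) =
      PX.real {y | invChristoffel m σ₀ N x y ≤ η} := by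
    refine measureReal_congr ?_
    filter_upwards [h𝒳] with y hy
    exact propext ⟨fun h => h.2, fun h => ⟨hy, h⟩⟩
  have hm : MeasurableSet {y | invChristoffel m σ₀ N x y ≤ η} :=
    measurableSet_le (continuous_invChristoffel m N x).measurable measurable_const
  have hrisk := (le_stochRisk m N x PX hσ₀ hη).trans
    (stochRisk_le_riskBound m hσ₀ hη hNpos hδ (hx N))
  have hcompl : PX.real {y | ¬ invChristoffel m σ₀ N x y ≤ η} =
      1 - PX.real {y | invChristoffel m σ₀ N x y ≤ η} := probReal_compl_eq_one_sub hm
  -- Only the sign matters: π² > 9 > 6δ, so the argument of the logarithm is at least 1.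
  have hlog : 0 ≤ 2 / (N : ℝ) * Real.log (Real.pi ^ 2 * ((k + 1 : ℕ) : ℝ) ^ 2 / (6 * δ)) := by
    refine mul_nonneg (by positivity) (Real.log_nonneg ?_)
    have hδ0 := hδ.1
    have hk : (1 : ℝ) ≤ ((k + 1 : ℕ) : ℝ) ^ 2 :=
      one_le_pow₀ (by push_cast; linarith [k.cast_nonneg (α := ℝ)])
    rw [one_le_div (by positivity)]
    nlinarith [Real.pi_gt_three, hδ.2]
  have hacc : 1 - PX.real {y | invChristoffel m σ₀ N x y ≤ η} ≤
      accuracy m σ₀ η δ N₀ Nb x (k + 1) := by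
    rw [accuracy, le_div_iff₀ hF, ← hcompl, mul_comm]
    linarith
  rw [hest]
  linarith

end ChristoffelPAC

theorem corollary3p10
    {n : ℕ} {Ω : Type*} [MeasurableSpace Ω] (μ : Measure Ω) [IsProbabilityMeasure μ]
    (PX : Measure (Fin n → ℝ)) [IsProbabilityMeasure PX]
    (𝒳 : Set (Fin n → ℝ)) (h𝒳 : ∀ᵐ y ∂PX, y ∈ 𝒳)
    (X : ℕ → Ω → Fin n → ℝ) (hX : ∀ j, Measurable (X j))
    (hindep : iIndepFun X μ) (hlaw : ∀ j, μ.map (X j) = PX)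
    (m : ℕ) (σ₀ η δ ε : ℝ) (hσ₀ : 0 < σ₀) (hη : 0 < η)
    (hδ : δ ∈ Set.Ioo (0 : ℝ) 1) (hε : ε ∈ Set.Ioo (0 : ℝ) 1)
    (N₀ Nb : ℕ) (hNb : 0 < Nb) :
    1 - δ ≤ μ.real {ω | ∀ i : ℕ, 1 ≤ i →
        1 - ChristoffelPAC.accuracy m σ₀ η δ N₀ Nb (fun j => X j ω) i ≤
          PX.real (ChristoffelPAC.estimate 𝒳 m σ₀ η N₀ Nb (fun j => X j ω) i)} ∧
    1 - δ ≤ μ.real {ω | ∀ T : ℕ,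
        ChristoffelPAC.StopsAt m σ₀ η δ ε N₀ Nb (fun j => X j ω) T →
          1 - ε ≤ PX.real (ChristoffelPAC.estimate 𝒳 m σ₀ η N₀ Nb (fun j => X j ω) T)} := by
  open ChristoffelPAC in
  have hE := measurableSet_errorSet (n := n) m η
  set V : ℕ → Ω → ℝ≥0∞ := fun N ω =>
    averagedRatio (errorSet n m η) PX (prior n m σ₀) N (fun j => X j ω)
  -- A single exceptional event serves all sample sizes, hence all iterations and the random
  -- stopping time.
  set bad : Set Ω := {ω | ∃ N, (ENNReal.ofReal δ)⁻¹ ≤ V N ω} with hbad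
  have hδ0 : ENNReal.ofReal δ ≠ 0 := by simpa using hδ.1
  have hbadm : MeasurableSet bad := by
    have : bad = ⋃ N, {ω | (ENNReal.ofReal δ)⁻¹ ≤ V N ω} := by ext ω; simp [hbad]
    rw [this]
    exact MeasurableSet.iUnion fun N =>
      measurableSet_le measurable_const (measurable_averagedRatio hE PX _ fun j _ => hX j)
  have hbadμ : μ.real bad ≤ δ := by
    have h := measure_averagedRatio_ge_le (prior n m σ₀) hX hindep hlaw hE (ENNReal.ofReal δ)⁻¹
    rw [ENNReal.inv_mul_le_iff hδ0 ENNReal.ofReal_ne_top, mul_one] at h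
    exact ENNReal.toReal_le_of_le_ofReal hδ.1.le h
  have hgood : 1 - δ ≤ μ.real badᶜ := by
    rw [probReal_compl_eq_one_sub hbadm]
    linarith
  have hmain ω (hω : ω ∈ badᶜ) (i : ℕ) (hi : 1 ≤ i) :
      1 - accuracy m σ₀ η δ N₀ Nb (fun j => X j ω) i ≤
        PX.real (estimate 𝒳 m σ₀ η N₀ Nb (fun j => X j ω) i) :=
    one_sub_accuracy_le m N₀ Nb hσ₀ hη hNb hδ h𝒳
      (fun N => lt_of_not_ge fun h => hω ⟨N, h⟩) hi
  -- Both events contain `badᶜ`, so monotonicity suffices without their measurability.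
  refine ⟨hgood.trans (measureReal_mono hmain), hgood.trans (measureReal_mono fun ω hω T hT => ?_)⟩
  -- Stopping at `T = 0` is impossible because ε^0 = 1 > ε.
  rcases Nat.eq_zero_or_pos T with rfl | hT0
  · exact absurd (show (1 : ℝ) ≤ ε from hT.1) (not_le.2 hε.2)
  · linarith [hmain ω hω T hT0, hT.1]
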